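/- Let $J$ and $K$ be (finite-dimensional, real) Lie groups with Lie algebras $\mathfrak j,\mathfrak k$, and $H=J\times K$, so that $\mathfrak h=\mathfrak j\oplus\mathfrak k$. Let $\pi:\mathcal P\to\mathcal M$ be a smooth $H$-principal bundle, $\omega$ a connection 1-form on $\mathcal P$, and $S:\mathcal P\to K$ a smooth map with $S(pk)=k^{-1}S(p)$ for all $p\in\mathcal P$, $k\in K$. Put $\mathcal Q=S^{-1}(\{e\})\subset\mathcal P$ with inclusion $\iota:\mathcal Q\to\mathcal P$, let $r:\mathcal P\to\mathcal Q$, $r(p)=pS(p)$, and let $\widehat\omega=S^{-1}\omega S+S^{-1}dS=\mathrm{Ad}_{S^{-1}}\omega+S^*\theta$, with $\theta$ the Maurer–Cartan form and $S$ regarded as a map into $H$. Superscripts $\mathfrak j,\mathfrak k$ denote components in $\mathfrak h=\mathfrak j\oplus\mathfrak k$. Then: 1. $\mathcal Q$ is an embedded submanifold of $\mathcal P$, and it is a $J$-principal bundle over $\mathcal M$, with projection $\pi\circ\iota$ and the right action $q\cdot j=r(qj)=(qj)\,S(qj)$ (the action of $J=H/K$ on $\mathcal P/K$, transported to $\mathcal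 Q\simeq\mathcal P/K$). Moreover $r(p(j,k))=r(p)\cdot j$, and $p\mapsto(r(p),S(p)^{-1})$ is a $K$-equivariant diffeomorphism $\mathcal P\to\mathcal Q\times K$, where $K$ acts on the second factor by right multiplication. 2. $\widehat\omega$ is a smooth 1-form, with $\widehat\omega=\omega^{\mathfrak j}\oplus\widehat\omega^{\mathfrak k}$ on $\mathcal P$ and $\widehat\omega=r^*\iota^*\widehat\omega$. Its restriction to $\mathcal Q$ is $\iota^*\widehat\omega=\omega^{\mathfrak j}_{\mathcal Q}\oplus\widehat\omega^{\mathfrak k}_{\mathcal Q}$, where $\omega^{\mathfrak j}_{\mathcal Q}=\iota^*\omega^{\mathfrak j}$ is a connection 1-form on the $J$-principal bundle $\mathcal Q$ and $\widehat\omega^{\mathfrak k}_{\mathcal Q}=\iota^*\widehat\omega^{\mathfrak k}$ is a smooth $\mathfrak k$-valued 1-form. 3. $\widehat\omega$, and hence $\widehat\omega^{\mathfrak k}$, is $K$-gauge invariant: let $\gamma:\mathcal P\to K\subset H$ be a gauge transformation, that is, a smooth map with $\gamma(ph)=h^{-1}\gamma(p)h$ for all $h\in H$, and let $\Psi(p)=p\gamma(p)$.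 Then $\omega^\gamma:=\Psi^*\omega=\gamma^{-1}\omega\gamma+\gamma^{-1}d\gamma$ and $S^\gamma:=\Psi^*S=\gamma^{-1}S$, and $(S^\gamma)^{-1}\omega^\gamma S^\gamma+(S^\gamma)^{-1}dS^\gamma=\widehat\omega$. -/

import Mathlib

open scoped Manifold ContDiff

noncomputable section

namespace Dressing

section General

variable {EM : Type*} [NormedAddCommGroup EM] [NormedSpace ℝ EM]
  {HM : Type*} [TopologicalSpace HM] (IM : ModelWithCorners ℝ EM HM)
  {EP : Type*} [NormedAddCommGroup EP] [NormedSpace ℝ EP]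
  {HP : Type*} [TopologicalSpace HP] (IP : ModelWithCorners ℝ EP HP)
  {EG : Type*} [NormedAddCommGroup EG] [NormedSpace ℝ EG]
  {HG : Type*} [TopologicalSpace HG] (IG : ModelWithCorners ℝ EG HG)
  {M : Type*} [TopologicalSpace M] [ChartedSpace HM M]
  {P : Type*} [TopologicalSpace P] [ChartedSpace HP P]
  {G : Type*} [TopologicalSpace G] [ChartedSpace HG G] [Group G]

/-- The manifold `P`, with the projection `π : P → M` and the right action `act p g = p g` of the
Lie group `G`, is a smooth principal `G`-bundle over the manifold `M`: a smooth right action,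
preserving the fibres of `π`, such that over a neighbourhood of each point of `M` there is
a `G`-equivariant diffeomorphism of `π⁻¹(U)` onto `U × G` over `U`. -/
structure IsPrincipalBundle (π : P → M) (act : P → G → P) : Prop where
  act_one : ∀ p, act p 1 = p
  act_mul : ∀ p g h, act p (g * h) = act (act p g) h
  contMDiff_act : ContMDiff (IP.prod IG) IP ∞ (fun x : P × G => act x.1 x.2)
  proj_act : ∀ p g, π (act p g) = π p
  locally_trivial : ∀ x : M, ∃ e : Bundle.Trivialization G π, x ∈ e.baseSet ∧
    ContMDiffOn IP (IM.prod IG) ∞ e e.source ∧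
    ContMDiffOn (IM.prod IG) IP ∞ e.toOpenPartialHomeomorph.symm e.target ∧
    ∀ p ∈ e.source, ∀ g, (e (act p g)).2 = (e p).2 * g

variable (P G) in
/-- Families of linear forms on the tangent spaces of `P` with values in the Lie algebra of `G`
(smoothness is the separate predicate `IsSmoothForm`). -/
abbrev LieForm : Type _ := ∀ p : P, TangentSpace IP p →L[ℝ] GroupLieAlgebra IG G

/-- A Lie algebra valued form is a smooth 1-form if it is smooth as a function on the tangent
bundle. The Lie algebra is a vector space with model space `EG`. -/
def IsSmoothForm [IsManifold IP ∞ P] (A : LieForm IP IG P G) : Prop :=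
  ContMDiff IP.tangent 𝓘(ℝ, EG) (M' := EG) ∞ (fun v : TangentBundle IP P => A v.proj v.snd)

/-- The pullback `f^* A` of a 1-form. -/
def pullback (f : M → P) (A : LieForm IP IG P G) : LieForm IM IG M G :=
  fun x => (A (f x)).comp (mfderiv IM IP f x)

/-- The adjoint action of `g` on the Lie algebra: the derivative at `1` of `x ↦ g x g⁻¹`. -/
def Ad (g : G) : GroupLieAlgebra IG G →L[ℝ] GroupLieAlgebra IG G :=
  mfderiv IG IG (fun x : G => g * x * g⁻¹) 1

/-- The Maurer-Cartan form of `G`: the derivative at `g` of left translation by `g⁻¹`. -/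
def maurerCartan (g : G) : TangentSpace IG g →L[ℝ] GroupLieAlgebra IG G :=
  mfderiv IG IG (fun x : G => g⁻¹ * x) g

/-- The composite form `u⁻¹ A u + u⁻¹ du`, for `u : P → G`. -/
def dress (A : LieForm IP IG P G) (u : P → G) : LieForm IP IG P G :=
  fun p => (Ad IG (u p)⁻¹).comp (A p) + (maurerCartan IG (u p)).comp (mfderiv IP IG u p)

/-- `A` is a (principal) connection 1-form for the right action `act` of `G` on `P`: it is smooth,
it reproduces the generators of the fundamental vector fields, and `R_g^* A = Ad(g⁻¹) A`. -/
structure IsConnection [IsManifold IP ∞ P] (act : P → G → P) (A : LieForm IP IG P G) : Prop where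
  smooth : IsSmoothForm IP IG A
  vertical : ∀ (p : P) (X : GroupLieAlgebra IG G),
    A (act p 1) (mfderiv IG IP (fun g => act p g) 1 X) = X
  equivariant : ∀ (g : G) (p : P) (v : TangentSpace IP p),
    A (act p g) (mfderiv IP IP (fun p' => act p' g) p v) = Ad IG g⁻¹ (A p v)

/-- A gauge transformation: a smooth map `γ : P → G` such that `γ(pg) = g⁻¹ γ(p) g`. -/
structure IsGaugeTransformation (act : P → G → P) (γ : P → G) : Prop where
  smooth : ContMDiff IP IG ∞ γ
  equivariant : ∀ p g, γ (act p g) = g⁻¹ * γ p * g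

/-- The vertical automorphism `p ↦ p γ(p)` attached to a gauge transformation `γ`. -/
def gaugeMap (act : P → G → P) (γ : P → G) : P → P := fun p => act p (γ p)

end General

section Product

variable {EJ : Type*} [NormedAddCommGroup EJ] [NormedSpace ℝ EJ]
  {HJ : Type*} [TopologicalSpace HJ] (IJ : ModelWithCorners ℝ EJ HJ)
  {EK : Type*} [NormedAddCommGroup EK] [NormedSpace ℝ EK]
  {HK : Type*} [TopologicalSpace HK] (IK : ModelWithCorners ℝ EK HK)
  {EP : Type*} [NormedAddCommGroup EP] [NormedSpace ℝ EP]
  {HP : Type*} [TopologicalSpace HP] (IP : ModelWithCorners ℝ EP HP)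
  {J : Type*} [TopologicalSpace J] [ChartedSpace HJ J] [Group J]
  {K : Type*} [TopologicalSpace K] [ChartedSpace HK K] [Group K]
  {P : Type*} [TopologicalSpace P] [ChartedSpace HP P]

variable (J K) in
/-- The projection `𝔥 = 𝔧 ⊕ 𝔨 → 𝔧`, for `H = J × K`. -/
def lieFst : GroupLieAlgebra (IJ.prod IK) (J × K) →L[ℝ] GroupLieAlgebra IJ J :=
  mfderiv (IJ.prod IK) IJ (Prod.fst : J × K → J) 1

variable (J K) in
/-- The projection `𝔥 = 𝔧 ⊕ 𝔨 → 𝔨`. -/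
def lieSnd : GroupLieAlgebra (IJ.prod IK) (J × K) →L[ℝ] GroupLieAlgebra IK K :=
  mfderiv (IJ.prod IK) IK (Prod.snd : J × K → K) 1

variable (J K) in
/-- The inclusion `𝔧 → 𝔧 ⊕ 𝔨 = 𝔥`. -/
def lieInl : GroupLieAlgebra IJ J →L[ℝ] GroupLieAlgebra (IJ.prod IK) (J × K) :=
  mfderiv IJ (IJ.prod IK) (fun j : J => (j, (1 : K))) 1

variable (J K) in
/-- The inclusion `𝔨 → 𝔧 ⊕ 𝔨 = 𝔥`. -/
def lieInr : GroupLieAlgebra IK K →L[ℝ] GroupLieAlgebra (IJ.prod IK) (J × K) :=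
  mfderiv IK (IJ.prod IK) (fun k : K => ((1 : J), k)) 1

/-- The component `A^𝔧` of an `𝔥`-valued form. -/
def fstPart (A : LieForm IP (IJ.prod IK) P (J × K)) : LieForm IP IJ P J :=
  fun p => (lieFst IJ IK J K).comp (A p)

/-- The component `A^𝔨` of an `𝔥`-valued form. -/
def sndPart (A : LieForm IP (IJ.prod IK) P (J × K)) : LieForm IP IK P K :=
  fun p => (lieSnd IJ IK J K).comp (A p)

/-- The form `α ⊕ β` with values in `𝔧 ⊕ 𝔨 = 𝔥`. -/
def directSum (α : LieForm IP IJ P J) (β : LieForm IP IK P K) :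
    LieForm IP (IJ.prod IK) P (J × K) :=
  fun p => (lieInl IJ IK J K).comp (α p) + (lieInr IJ IK J K).comp (β p)

variable (J) in
/-- A `K`-valued map, as a map with values in `H = J × K`. -/
def inK {X : Type*} (u : X → K) : X → J × K := fun x => (1, u x)

end Product

section Reduction

variable {J K P : Type*} [Group J] [Group K]

/-- The retraction `p ↦ p S(p)` of `P` onto `Q = S⁻¹(e)`; its fibres are the `K`-orbits when `act`
is a right action, so that it identifies `P / K` with `Q`. -/
def retract (act : P → J × K → P) (S : P → K)
    (hSK : ∀ p k, S (act p (1, k)) = k⁻¹ * S p) (p : P) : ↥(S ⁻¹' {1}) :=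
  ⟨act p (1, S p), by simp [hSK]⟩

/-- The right action of `J` on `Q = S⁻¹(e)`. It is the action `[p]_K j = [p j]_K` of `J = H / K` on
`P / K`, transported by `P / K ≃ Q`; explicitly, `q · j = (q j) S(q j)`. -/
def actQ (act : P → J × K → P) (S : P → K)
    (hSK : ∀ p k, S (act p (1, k)) = k⁻¹ * S p) (q : ↥(S ⁻¹' {1})) (j : J) : ↥(S ⁻¹' {1}) :=
  retract act S hSK (act q (j, 1))

end Reduction

end Dressing

end

open scoped Manifold ContDiff
noncomputable section
namespace Dressing

/-! ### Pullbacks of Lie algebra valued forms, and the derivative of p ↦ p u(p). -/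

section General

variable {EM : Type*} [NormedAddCommGroup EM] [NormedSpace ℝ EM]
  {HM : Type*} [TopologicalSpace HM] {IM : ModelWithCorners ℝ EM HM}
  {EP : Type*} [NormedAddCommGroup EP] [NormedSpace ℝ EP]
  {HP : Type*} [TopologicalSpace HP] {IP : ModelWithCorners ℝ EP HP}
  {EN : Type*} [NormedAddCommGroup EN] [NormedSpace ℝ EN]
  {HN : Type*} [TopologicalSpace HN] {IN : ModelWithCorners ℝ EN HN}
  {EG : Type*} [NormedAddCommGroup EG] [NormedSpace ℝ EG]
  {HG : Type*} [TopologicalSpace HG] {IG : ModelWithCorners ℝ EG HG}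
  {M : Type*} [TopologicalSpace M] [ChartedSpace HM M]
  {P : Type*} [TopologicalSpace P] [ChartedSpace HP P]
  {N : Type*} [TopologicalSpace N] [ChartedSpace HN N]
  {G : Type*} [TopologicalSpace G] [ChartedSpace HG G] [Group G]

/-! Write R : P → P for p ↦ p S(p), the map underlying `retract`. For any u : P → H, the pullback of
a connection by p ↦ p u(p) is u⁻¹ A u + u⁻¹ du (`pullback_act_eq_dress`), so the dressed form is R^*
A (`dress_eq_pullback`). This gives its smoothness. As R ∘ R = R, it equals r^* ι^* of itself; as R
∘ Ψ = R for every Ψ moving points along K-orbits, it is K-gauge invariant.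

The manifold Q is built by hand. An equivariant trivialization of P, followed by forgetting the
K-coordinate, trivializes Q; with charts of M and J this gives an atlas whose smooth structure is
the one induced from P (`HasInducedCharts`). Smoothness of maps into Q can then be tested in P. The
diffeomorphism P ≃ Q × K sends Q to the slice over 1, so the inclusion is an immersion without any
regular value argument.

The projection H → J is a homomorphism, so the 𝔧-part of u⁻¹ A u + u⁻¹ du involves only the
J-component of u (`fstPart_dress`). That component is constant both for the dressing field and for
the J-action on Q, whose correction S(qj) is K-valued. Hence dressing leaves the 𝔧-part unchanged,
and its restriction to Q is a J-connection. -/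

theorem pullback_pullback {f : N → M} {g : M → P} (A : LieForm IP IG P G)
    (hg : MDifferentiable IM IP g) (hf : MDifferentiable IN IM f) :
    pullback IN IM IG f (pullback IM IP IG g A) = pullback IN IP IG (g ∘ f) A := by
  funext x
  simp only [pullback]
  rw [mfderiv_comp x (hg _) (hf x)]
  rfl

/-- Naturality of dressing, by the chain rule for u ∘ f. It reduces gauge invariance to an identity
between maps P → P. -/
theorem pullback_dress {f : M → P} (A : LieForm IP IG P G) {u : P → G}
    (hf : MDifferentiable IM IP f) (hu : MDifferentiable IP IG u) :
    pullback IM IP IG f (dress IP IG A u) = dress IM IG (pullback IM IP IG f A) (u ∘ f) := by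
  funext x
  simp only [pullback, dress]
  rw [mfderiv_comp x (hu _) (hf x)]
  rfl

theorem IsSmoothForm.pullback [IsManifold IM ∞ M] [IsManifold IP ∞ P] {f : M → P}
    {A : LieForm IP IG P G} (hA : IsSmoothForm IP IG A) (hf : ContMDiff IM IP ∞ f) :
    IsSmoothForm IM IG (pullback IM IP IG f A) :=
  ContMDiff.comp hA (hf.contMDiff_tangentMap (m := ∞) le_rfl)

/-- An equality of base points allows to compare the values of a form at two points. -/
theorem LieForm.congr_point (A : LieForm IP IG P G) {p q : P} (h : p = q) (v : EP) :
    (A p (v : TangentSpace IP p) : EG) = A q (v : TangentSpace IP q) := by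
  subst h; rfl

variable {π : P → M} {act : P → G → P}

/-- A connection form reproduces, through the Maurer-Cartan form, the derivatives of the orbit
maps at all points of the group. -/
theorem IsConnection.apply_mfderiv_orbit [LieGroup IG ∞ G] [IsManifold IP ∞ P]
    (hP : IsPrincipalBundle IM IP IG π act) {A : LieForm IP IG P G} (hA : IsConnection IP IG act A)
    (p : P) (g : G) (w : TangentSpace IG g) :
    A (act p g) (mfderiv IG IP (fun g' => act p g') g w) = maurerCartan IG g w := by
  have hact : ∀ q : P, MDifferentiable IG IP (fun g' => act q g') := fun q =>
    (hP.contMDiff_act.comp (contMDiff_const.prodMk contMDiff_id)).mdifferentiable (by simp)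
  have hmul : MDifferentiable IG IG (fun x : G => g⁻¹ * x) :=
    (contMDiff_mul_left (n := ∞)).mdifferentiable (by simp)
  -- The orbit map of p near g is the orbit map of pg near 1 after left translation by g⁻¹, whose
  -- derivative at g is the Maurer-Cartan form.
  have hfun : (fun g' => act p g') = (fun g' => act (act p g) g') ∘ fun x => g⁻¹ * x := by
    funext x
    simp [← hP.act_mul]
  have hd : mfderiv IG IP (fun g' => act p g') g w =
      (mfderiv IG IP (fun g' => act (act p g) g') 1 (maurerCartan IG g w) : EP) := by
    rw [hfun]
    exact mfderiv_comp_apply_of_eq g (hact (act p g) 1) (hmul g) (inv_mul_cancel g) w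
  have h := hA.vertical (act p g) (maurerCartan IG g w)
  rw [← h]
  refine Eq.trans ?_ (LieForm.congr_point A (hP.act_one (act p g)).symm _)
  exact congrArg (A (act p g)) hd

/-- The pullback of a connection form by `p ↦ p u(p)` is `u⁻¹ A u + u⁻¹ du`. -/
theorem pullback_act_eq_dress [LieGroup IG ∞ G] [IsManifold IP ∞ P]
    (hP : IsPrincipalBundle IM IP IG π act) {A : LieForm IP IG P G} (hA : IsConnection IP IG act A)
    {u : P → G} (hu : MDifferentiable IP IG u) :
    pullback IP IP IG (fun p => act p (u p)) A = dress IP IG A u := by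
  funext p
  ext v
  have hact : MDifferentiable (IP.prod IG) IP (fun x : P × G => act x.1 x.2) :=
    hP.contMDiff_act.mdifferentiable (by simp)
  have hpair : MDifferentiableAt IP (IP.prod IG) (fun p => (p, u p)) p :=
    mdifferentiableAt_id.prodMk (hu p)
  -- Product rule: vary the point with the group element frozen, then the reverse. The `equivariant`
  -- axiom evaluates the first term and `apply_mfderiv_orbit` the second.
  have hd : mfderiv IP IP (fun p => act p (u p)) p v =
      (mfderiv IP IP (fun p' => act p' (u p)) p v +
        mfderiv IG IP (fun g => act p g) (u p) (mfderiv IP IG u p v) : EP) := by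
    have h1 := mfderiv_comp_apply p (hact (p, u p)) hpair v
    have h2 := mfderiv_prodMk (mdifferentiableAt_id (I := IP) (x := p)) (hu p)
    have h3 := mfderiv_prod_eq_add_apply (v := mfderiv IP (IP.prod IG) (fun p => (p, u p)) p v)
      (hact (p, u p))
    refine h1.trans (h3.trans ?_)
    erw [h2]
    simp only [mfderiv_id]
    rfl
  refine (congrArg (A (act p (u p))) hd).trans ?_
  refine (map_add (A (act p (u p))) _ _).trans ?_
  exact congrArg₂ (· + ·) (hA.equivariant (u p) p v)
    (hA.apply_mfderiv_orbit hP p (u p) (mfderiv IP IG u p v))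

end General

/-! ### Smooth structures induced by a map into a manifold. -/

section InducedCharts

open Topology

variable {E : Type*} [NormedAddCommGroup E] [NormedSpace ℝ E]
  {EP : Type*} [NormedAddCommGroup EP] [NormedSpace ℝ EP]
  {HP : Type*} [TopologicalSpace HP] {IP : ModelWithCorners ℝ EP HP}
  {EN : Type*} [NormedAddCommGroup EN] [NormedSpace ℝ EN]
  {HN : Type*} [TopologicalSpace HN] {IN : ModelWithCorners ℝ EN HN}
  {P : Type*} [TopologicalSpace P] [ChartedSpace HP P]
  {N : Type*} [TopologicalSpace N] [ChartedSpace HN N]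
  {Q : Type*} [TopologicalSpace Q] [ChartedSpace E Q]

variable (E IP) in
/-- The charts of `Q` have inverses which are smooth as maps into `P`, and they extend locally to
smooth functions on `P`. -/
structure HasInducedCharts (f : Q → P) : Prop where
  isInducing : IsInducing f
  contMDiffOn_symm : ∀ c ∈ atlas E Q, ContMDiffOn 𝓘(ℝ, E) IP ∞ (f ∘ c.symm) c.target
  extends_chart : ∀ c ∈ atlas E Q, ∃ F : P → E, ∀ q ∈ c.source,
    F (f q) = c q ∧ ContMDiffAt IP 𝓘(ℝ, E) ∞ F (f q)

namespace HasInducedCharts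

variable {f : Q → P}

/-- A transition map c' ∘ c⁻¹ is F ∘ (f ∘ c⁻¹), with F an extension of c' to P, and both factors are
smooth. -/
theorem isManifold (h : HasInducedCharts E IP f) : IsManifold 𝓘(ℝ, E) ∞ Q := by
  refine isManifold_of_contDiffOn _ _ _ fun c c' hc hc' => ?_
  obtain ⟨F, hF⟩ := h.extends_chart c' hc'
  rw [← contMDiffOn_iff_contDiffOn]
  intro y hy
  have hy1 : y ∈ c.target ∧ c.symm y ∈ c'.source := by simpa using hy
  have hsymm := (h.contMDiffOn_symm c hc).contMDiffAt (c.open_target.mem_nhds hy1.1)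
  have hcomp : ContMDiffAt 𝓘(ℝ, E) 𝓘(ℝ, E) ∞ (F ∘ (f ∘ c.symm)) y :=
    ContMDiffAt.comp y (hF _ hy1.2).2 hsymm
  refine hcomp.contMDiffWithinAt.congr (fun z hz => ?_) ?_
  · have hz1 : z ∈ c.target ∧ c.symm z ∈ c'.source := by simpa using hz
    simpa using ((hF _ hz1.2).1).symm
  · simpa using ((hF _ hy1.2).1).symm

theorem contMDiff (h : HasInducedCharts E IP f) : ContMDiff 𝓘(ℝ, E) IP ∞ f := by
  have := h.isManifold
  intro q
  have h1 : ContMDiffAt 𝓘(ℝ, E) 𝓘(ℝ, E) ∞ (chartAt E q) q :=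
    contMDiffAt_of_mem_maximalAtlas (IsManifold.chart_mem_maximalAtlas q) (mem_chart_source E q)
  have h2 := (h.contMDiffOn_symm _ (chart_mem_atlas E q)).contMDiffAt
    ((chartAt E q).open_target.mem_nhds (mem_chart_target E q))
  refine (ContMDiffAt.comp q h2 h1).congr_of_eventuallyEq ?_
  filter_upwards [(chartAt E q).open_source.mem_nhds (mem_chart_source E q)] with x hx
  simp [(chartAt E q).left_inv hx]

/-- Since f is inducing, g is continuous and stays near x in the domain of one chart c; there g =
c⁻¹ ∘ F ∘ (f ∘ g). -/
theorem contMDiffWithinAt_of_comp (h : HasInducedCharts E IP f) {g : N → Q} {s : Set N} {x : N}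
    (hg : ContMDiffWithinAt IN IP ∞ (f ∘ g) s x) : ContMDiffWithinAt IN 𝓘(ℝ, E) ∞ g s x := by
  have := h.isManifold
  have hcont : ContinuousWithinAt g s x := h.isInducing.continuousWithinAt_iff.2
    hg.continuousWithinAt
  obtain ⟨F, hF⟩ := h.extends_chart _ (chart_mem_atlas E (g x))
  have hx := mem_chart_source E (g x)
  have h1 : ContMDiffWithinAt IN 𝓘(ℝ, E) ∞ (F ∘ (f ∘ g)) s x :=
    ContMDiffAt.comp_contMDiffWithinAt x (hF (g x) hx).2 hg
  have h2 : ContMDiffAt 𝓘(ℝ, E) 𝓘(ℝ, E) ∞ (chartAt E (g x)).symm ((F ∘ (f ∘ g)) x) := by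
    refine contMDiffAt_symm_of_mem_maximalAtlas (IsManifold.chart_mem_maximalAtlas (g x)) ?_
    simp [(hF (g x) hx).1]
  refine (h2.comp_contMDiffWithinAt x h1).congr_of_eventuallyEq ?_ ?_
  · filter_upwards [hcont.preimage_mem_nhdsWithin
      ((chartAt E (g x)).open_source.mem_nhds hx)] with y hy
    have hy' : g y ∈ (chartAt E (g x)).source := hy
    simp [(hF _ hy').1, (chartAt E (g x)).left_inv hy']
  · simp [(hF _ hx).1, (chartAt E (g x)).left_inv hx]

theorem contMDiffOn_of_comp (h : HasInducedCharts E IP f) {g : N → Q} {s : Set N}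
    (hg : ContMDiffOn IN IP ∞ (f ∘ g) s) : ContMDiffOn IN 𝓘(ℝ, E) ∞ g s :=
  fun x hx => h.contMDiffWithinAt_of_comp (hg x hx)

theorem contMDiff_of_comp (h : HasInducedCharts E IP f) {g : N → Q}
    (hg : ContMDiff IN IP ∞ (f ∘ g)) : ContMDiff IN 𝓘(ℝ, E) ∞ g :=
  contMDiffOn_univ.1 (h.contMDiffOn_of_comp hg.contMDiffOn)

end HasInducedCharts

/-- A slice `q ↦ (q, k₀)` of a product decomposition `P ≃ Q × K` is an immersion into `P`. -/
theorem isImmersionOfComplement_of_diffeomorph_prod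
    {EK : Type*} [NormedAddCommGroup EK] [NormedSpace ℝ EK]
    {K : Type*} [TopologicalSpace K] [ChartedSpace EK K] [IsManifold 𝓘(ℝ, EK) ∞ K]
    {P : Type*} [TopologicalSpace P] [ChartedSpace EP P] [IsManifold 𝓘(ℝ, EP) ∞ P]
    [IsManifold 𝓘(ℝ, E) ∞ Q]
    (Φ : P ≃ₘ^∞⟮𝓘(ℝ, EP), 𝓘(ℝ, E).prod 𝓘(ℝ, EK)⟯ (Q × K)) (k₀ : K) {f : Q → P}
    (hf : ∀ q, Φ (f q) = (q, k₀)) :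
    Manifold.IsImmersionOfComplement EK 𝓘(ℝ, E) 𝓘(ℝ, EP) ∞ f := by
  intro q
  -- Any linear isomorphism E × EK ≃ EP would do; the derivative of Φ supplies one.
  let L : (E × EK) ≃L[ℝ] EP := (Φ.mfderivToContinuousLinearEquiv (by simp) (f q)).symm
  -- The chart of K is translated so that k₀ goes to 0, because the normal form of an immersion is u
  -- ↦ (u, 0).
  let c : OpenPartialHomeomorph (Q × K) (E × EK) :=
    (chartAt E q).prod ((chartAt EK k₀).trans
      (Homeomorph.addRight (-(chartAt EK k₀ k₀))).toOpenPartialHomeomorph)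
  let ψ : OpenPartialHomeomorph P EP := Φ.toHomeomorph.toOpenPartialHomeomorph ≫ₕ
    c ≫ₕ L.toHomeomorph.toOpenPartialHomeomorph
  have hc : ∀ {x}, c.source ∈ 𝓝 x → ContMDiffAt (𝓘(ℝ, E).prod 𝓘(ℝ, EK)) 𝓘(ℝ, E × EK) ∞ c x := by
    intro x hx
    have hx' : x.1 ∈ (chartAt E q).source ∧ x.2 ∈ (chartAt EK k₀).source := by
      simpa [c] using mem_of_mem_nhds hx
    rw [modelWithCornersSelf_prod, ← chartedSpaceSelf_prod]
    refine ContMDiffAt.prodMk ?_ ?_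
    · exact (contMDiffAt_of_mem_maximalAtlas (IsManifold.chart_mem_maximalAtlas q) hx'.1).comp x
        contMDiffAt_fst
    · exact ((contDiff_id.add contDiff_const).contMDiff _).comp x ((contMDiffAt_of_mem_maximalAtlas
        (IsManifold.chart_mem_maximalAtlas k₀) hx'.2).comp x contMDiffAt_snd)
  have hc' : ∀ {y}, c.target ∈ 𝓝 y →
      ContMDiffAt 𝓘(ℝ, E × EK) (𝓘(ℝ, E).prod 𝓘(ℝ, EK)) ∞ c.symm y := by
    intro y hy
    have hy' : y.1 ∈ (chartAt E q).target ∧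
        y.2 + chartAt EK k₀ k₀ ∈ (chartAt EK k₀).target := by
      simpa [c, Homeomorph.addRight_symm] using mem_of_mem_nhds hy
    refine ContMDiffAt.prodMk ?_ ?_
    · exact (contMDiffAt_symm_of_mem_maximalAtlas (IsManifold.chart_mem_maximalAtlas q)
        hy'.1).comp y (contDiff_fst.contMDiff y)
    · refine ContMDiffAt.comp (g := (chartAt EK k₀).symm)
        (f := fun z : E × EK => z.2 + - -(chartAt EK k₀ k₀)) y ?_
        ((contDiff_snd.add contDiff_const).contMDiff y)
      exact contMDiffAt_symm_of_mem_maximalAtlas (IsManifold.chart_mem_maximalAtlas k₀)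
        (by simpa using hy'.2)
  have hfun : f = fun q => Φ.symm (q, k₀) := by
    funext q
    rw [← hf q, Φ.symm_apply_apply]
  have hcont : Continuous f := by
    rw [hfun]
    exact Φ.symm.continuous.comp (by fun_prop)
  refine Manifold.IsImmersionAtOfComplement.mk_of_continuousAt hcont.continuousAt L
    (chartAt E q) ψ (mem_chart_source E q) ?_ (IsManifold.chart_mem_maximalAtlas q) ?_ ?_
  · simp [ψ, c, hf]
  · apply OpenPartialHomeomorph.mem_maximalAtlas_of_contMDiffOn
    · intro p hp
      have hp' : Φ p ∈ c.source := by simpa [ψ] using hp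
      exact ((L.contDiff.contMDiff _).comp p ((hc (c.open_source.mem_nhds hp')).comp p
        (Φ.contMDiff p))).contMDiffWithinAt
    · intro y hy
      have hy' : L.symm y ∈ c.target := by simpa [ψ] using hy
      exact ((Φ.symm.contMDiff _).comp y ((hc' (c.open_target.mem_nhds hy')).comp y
        (L.symm.contDiff.contMDiff y))).contMDiffWithinAt
  · intro y hy
    have hy' : y ∈ (chartAt E q).target := by simpa using hy
    simp [ψ, c, hf, (chartAt E q).right_inv hy']

end InducedCharts

/-! ### The retraction and the local triviality of the reduced bundle. -/

section Algebra

variable {J K P : Type*} [Group J] [Group K] {act : P → J × K → P} {S : P → K}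

theorem coe_retract (hSK : ∀ p k, S (act p (1, k)) = k⁻¹ * S p) (p : P) :
    (retract act S hSK p : P) = act p (1, S p) := rfl

theorem apply_coe_eq_one (q : ↥(S ⁻¹' {1})) : S q = 1 := q.2

end Algebra

section Reduction

variable {EM : Type*} [NormedAddCommGroup EM] [NormedSpace ℝ EM]
  {HM : Type*} [TopologicalSpace HM] {IM : ModelWithCorners ℝ EM HM}
  {EP : Type*} [NormedAddCommGroup EP] [NormedSpace ℝ EP]
  {HP : Type*} [TopologicalSpace HP] {IP : ModelWithCorners ℝ EP HP}
  {EJ : Type*} [NormedAddCommGroup EJ] [NormedSpace ℝ EJ]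
  {HJ : Type*} [TopologicalSpace HJ] {IJ : ModelWithCorners ℝ EJ HJ}
  {EK : Type*} [NormedAddCommGroup EK] [NormedSpace ℝ EK]
  {HK : Type*} [TopologicalSpace HK] {IK : ModelWithCorners ℝ EK HK}
  {M : Type*} [TopologicalSpace M] [ChartedSpace HM M]
  {P : Type*} [TopologicalSpace P] [ChartedSpace HP P]
  {J : Type*} [TopologicalSpace J] [ChartedSpace HJ J] [Group J]
  {K : Type*} [TopologicalSpace K] [ChartedSpace HK K] [Group K]
  {π : P → M} {act : P → J × K → P} {S : P → K}
  (hP : IsPrincipalBundle IM IP (IJ.prod IK) π act)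
  (hS : ContMDiff IP IK ∞ S)
  (hSK : ∀ p k, S (act p (1, k)) = k⁻¹ * S p)

include hP

theorem IsPrincipalBundle.retract_act_snd (p : P) (k : K) :
    retract act S hSK (act p (1, k)) = retract act S hSK p := by
  apply Subtype.ext
  simp [coe_retract, hSK, ← hP.act_mul]

theorem IsPrincipalBundle.retract_coe (q : ↥(S ⁻¹' {1})) : retract act S hSK q = q := by
  apply Subtype.ext
  rw [coe_retract, apply_coe_eq_one (S := S) q]
  exact hP.act_one q

/-- The retraction is constant on K-orbits, and J and K commute inside H, so the factors k and S(p)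
can both be moved to the right and dropped. -/
theorem IsPrincipalBundle.retract_act (p : P) (j : J) (k : K) :
    retract act S hSK (act p (j, k)) = actQ act S hSK (retract act S hSK p) j := by
  have h : ∀ k, retract act S hSK (act p (j, k)) = retract act S hSK (act p (j, 1)) := by
    intro k
    rw [← hP.retract_act_snd hSK (act p (j, 1)) k, ← hP.act_mul]
    simp
  rw [actQ, coe_retract, ← hP.act_mul, h]
  simp [h]

include hS in
theorem IsPrincipalBundle.contMDiff_coe_retract :
    ContMDiff IP IP ∞ (fun p => (retract act S hSK p : P)) :=
  hP.contMDiff_act.comp (contMDiff_id.prodMk (contMDiff_const.prodMk hS))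

include hS in
theorem IsPrincipalBundle.continuous_retract : Continuous (retract act S hSK) :=
  (hP.contMDiff_coe_retract hS hSK).continuous.subtype_mk _

/-- Both points lie in the source of e, where e is injective and equivariant. -/
theorem IsPrincipalBundle.symm_apply_mul {e : Bundle.Trivialization (J × K) π}
    (he : ∀ p ∈ e.source, ∀ g, (e (act p g)).2 = (e p).2 * g) {x : M} (hx : x ∈ e.baseSet)
    (h g : J × K) : e.toOpenPartialHomeomorph.symm (x, h * g) =
      act (e.toOpenPartialHomeomorph.symm (x, h)) g := by
  have ht : ∀ h, (x, h) ∈ e.target := fun h => by simp [e.target_eq, hx]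
  have hs : ∀ h, e.toOpenPartialHomeomorph.symm (x, h) ∈ e.source := fun h =>
    e.toOpenPartialHomeomorph.map_target (ht h)
  have hs' : act (e.toOpenPartialHomeomorph.symm (x, h)) g ∈ e.source := by
    rw [e.mem_source, hP.proj_act, e.proj_symm_apply (ht h)]
    exact hx
  apply e.injOn (hs _) hs'
  rw [e.coe_coe, e.apply_symm_apply (ht _)]
  refine Prod.ext ?_ ?_
  · rw [e.coe_fst hs', hP.proj_act, e.proj_symm_apply (ht h)]
  · rw [he _ (hs h), e.apply_symm_apply (ht h)]

/-- The local trivialization of the reduced bundle `S⁻¹(e)` induced by an equivariant local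
trivialization of `P`. -/
def IsPrincipalBundle.reducedTrivialization (e : Bundle.Trivialization (J × K) π)
    (he : ∀ p ∈ e.source, ∀ g, (e (act p g)).2 = (e p).2 * g) :
    Bundle.Trivialization J (fun q : ↥(S ⁻¹' {1}) => π q) where
  toFun q := (π q, (e q).2.1)
  invFun y := retract act S hSK (e.toOpenPartialHomeomorph.symm (y.1, (y.2, 1)))
  source := (fun q : ↥(S ⁻¹' {1}) => π q) ⁻¹' e.baseSet
  target := e.baseSet ×ˢ Set.univ
  baseSet := e.baseSet
  open_baseSet := e.open_baseSet
  source_eq := rfl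
  target_eq := rfl
  proj_toFun _ _ := rfl
  map_source' q hq := by simpa using hq
  map_target' y hy := by
    have hy' : y.1 ∈ e.baseSet := by simpa using hy
    simpa [coe_retract, hP.proj_act, e.proj_symm_apply' hy'] using hy'
  -- If e(q) = (x, (j, k)), then q is e⁻¹(x, (j, 1)) moved by k. The retraction does not see k, and
  -- it fixes q.
  left_inv' q hq := by
    have hq' : (q : P) ∈ e.source := e.mem_source.2 hq
    have h := hP.symm_apply_mul he hq ((e q).2.1, 1) (1, (e q).2.2)
    simp only [Prod.mk_mul_mk, mul_one, one_mul] at h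
    have h2 : e.toOpenPartialHomeomorph.symm (π q, (e q).2) = q := e.symm_apply_mk_proj hq'
    rw [← hP.retract_act_snd hSK _ (e q).2.2, ← h, h2, hP.retract_coe]
  right_inv' y hy := by
    have hy' : y.1 ∈ e.baseSet := by simpa using hy
    have hs : e.toOpenPartialHomeomorph.symm (y.1, (y.2, 1)) ∈ e.source :=
      e.toOpenPartialHomeomorph.map_target (by simp [e.target_eq, hy'])
    refine Prod.ext ?_ ?_
    · simp [coe_retract, hP.proj_act, e.proj_symm_apply' hy']
    · simp [coe_retract, he _ hs, e.apply_symm_apply' hy']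
  open_source := by
    have h : (fun q : ↥(S ⁻¹' {1}) => π q) ⁻¹' e.baseSet = Subtype.val ⁻¹' e.source := by
      ext q
      simp [e.mem_source]
    rw [h]
    exact e.open_source.preimage continuous_subtype_val
  open_target := e.open_baseSet.prod isOpen_univ
  continuousOn_toFun := by
    have h : ContinuousOn (fun q : ↥(S ⁻¹' {1}) => e q)
        ((fun q : ↥(S ⁻¹' {1}) => π q) ⁻¹' e.baseSet) :=
      e.toOpenPartialHomeomorph.continuousOn.comp continuous_subtype_val.continuousOn
        fun q hq => e.mem_source.2 hq
    exact (h.fst.prodMk h.snd.fst).congr fun q hq =>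
      Prod.ext (e.coe_fst (e.mem_source.2 hq)).symm rfl
  continuousOn_invFun := (hP.continuous_retract hS hSK).comp_continuousOn
    (e.toOpenPartialHomeomorph.continuousOn_symm.comp (by fun_prop) fun y hy => by
      have hy' : y.1 ∈ e.baseSet := by simpa using hy
      simp [e.target_eq, hy'])

end Reduction

/-! ### The reduced bundle as a manifold and as a principal J-bundle. -/

section Charts

variable {EM : Type*} [NormedAddCommGroup EM] [NormedSpace ℝ EM]
  {EP : Type*} [NormedAddCommGroup EP] [NormedSpace ℝ EP]
  {HP : Type*} [TopologicalSpace HP] {IP : ModelWithCorners ℝ EP HP}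
  {EJ : Type*} [NormedAddCommGroup EJ] [NormedSpace ℝ EJ]
  {EK : Type*} [NormedAddCommGroup EK] [NormedSpace ℝ EK]
  {HK : Type*} [TopologicalSpace HK] {IK : ModelWithCorners ℝ EK HK}
  {M : Type*} [TopologicalSpace M] [ChartedSpace EM M]
  {P : Type*} [TopologicalSpace P] [ChartedSpace HP P]
  {J : Type*} [TopologicalSpace J] [ChartedSpace EJ J] [Group J]
  {K : Type*} [TopologicalSpace K] [ChartedSpace HK K] [Group K]
  {π : P → M} {act : P → J × K → P} {S : P → K}
  (hP : IsPrincipalBundle 𝓘(ℝ, EM) IP (𝓘(ℝ, EJ).prod IK) π act)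
  (hS : ContMDiff IP IK ∞ S)
  (hSK : ∀ p k, S (act p (1, k)) = k⁻¹ * S p)

/-- An equivariant smooth local trivialization near a given point of the base. -/
def IsPrincipalBundle.trivializationAt (x : M) : Bundle.Trivialization (J × K) π :=
  (hP.locally_trivial x).choose

theorem IsPrincipalBundle.trivializationAt_spec (x : M) :
    x ∈ (hP.trivializationAt x).baseSet ∧
    ContMDiffOn IP (𝓘(ℝ, EM).prod (𝓘(ℝ, EJ).prod IK)) ∞ (hP.trivializationAt x)
      (hP.trivializationAt x).source ∧
    ContMDiffOn (𝓘(ℝ, EM).prod (𝓘(ℝ, EJ).prod IK)) IP ∞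
      (hP.trivializationAt x).toOpenPartialHomeomorph.symm (hP.trivializationAt x).target ∧
    ∀ p ∈ (hP.trivializationAt x).source, ∀ g,
      (hP.trivializationAt x (act p g)).2 = (hP.trivializationAt x p).2 * g :=
  (hP.locally_trivial x).choose_spec

/-- The chart of the reduced bundle `S⁻¹(e)` given by a local trivialization of `P` and charts of
`M` and `J`. -/
def IsPrincipalBundle.reducedChart (q : ↥(S ⁻¹' {1})) :
    OpenPartialHomeomorph ↥(S ⁻¹' {1}) (EM × EJ) :=
  (hP.reducedTrivialization hS hSK (hP.trivializationAt (π q))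
    (hP.trivializationAt_spec (π q)).2.2.2).toOpenPartialHomeomorph ≫ₕ
    (chartAt EM (π q)).prod (chartAt EJ (hP.trivializationAt (π q) q).2.1)

/-- The reduced bundle `S⁻¹(e)` as a manifold. -/
abbrev IsPrincipalBundle.reducedChartedSpace : ChartedSpace (EM × EJ) ↥(S ⁻¹' {1}) where
  atlas := Set.range (hP.reducedChart hS hSK)
  chartAt := hP.reducedChart hS hSK
  mem_chart_source q := by
    have h := (hP.trivializationAt_spec (π q)).1
    simp only [reducedChart, OpenPartialHomeomorph.trans_source, Set.mem_inter_iff,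
      Set.mem_preimage]
    exact ⟨h, mem_chart_source EM (π q), mem_chart_source EJ _⟩
  chart_mem_atlas q := ⟨q, rfl⟩

theorem IsPrincipalBundle.contMDiffOn_reducedTrivialization_symm
    (e : Bundle.Trivialization (J × K) π)
    (he : ∀ p ∈ e.source, ∀ g, (e (act p g)).2 = (e p).2 * g)
    (hsymm : ContMDiffOn (𝓘(ℝ, EM).prod (𝓘(ℝ, EJ).prod IK)) IP ∞
      e.toOpenPartialHomeomorph.symm e.target) :
    ContMDiffOn (𝓘(ℝ, EM).prod 𝓘(ℝ, EJ)) IP ∞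
      (Subtype.val ∘ (hP.reducedTrivialization hS hSK e he).toOpenPartialHomeomorph.symm)
      (hP.reducedTrivialization hS hSK e he).target := by
  have h1 : ContMDiff (𝓘(ℝ, EM).prod 𝓘(ℝ, EJ)) (𝓘(ℝ, EM).prod (𝓘(ℝ, EJ).prod IK)) ∞
      (fun y : M × J => (y.1, (y.2, (1 : K)))) :=
    contMDiff_fst.prodMk (contMDiff_snd.prodMk contMDiff_const)
  refine (hP.contMDiff_coe_retract hS hSK).comp_contMDiffOn
    (hsymm.comp h1.contMDiffOn fun y hy => ?_)
  have hy' : y.1 ∈ e.baseSet :=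
    ((hP.reducedTrivialization hS hSK e he).mem_target).1 hy
  simp [e.target_eq, hy']

omit [Group J] [Group K] in
theorem contMDiffAt_trivialization_fst {e : Bundle.Trivialization (J × K) π}
    (hsm : ContMDiffOn IP (𝓘(ℝ, EM).prod (𝓘(ℝ, EJ).prod IK)) ∞ e e.source) {p : P}
    (hp : p ∈ e.source) :
    ContMDiffAt IP (𝓘(ℝ, EM).prod 𝓘(ℝ, EJ)) ∞ (fun p => ((e p).1, (e p).2.1)) p := by
  have h := hsm.contMDiffAt (e.open_source.mem_nhds hp)
  exact h.fst.prodMk h.snd.fst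

/-- Inverse charts factor through e⁻¹ and the retraction, both smooth into P; the charts extend off
Q because e is defined on an open subset of P. -/
theorem IsPrincipalBundle.hasInducedCharts [IsManifold 𝓘(ℝ, EM) ∞ M] [IsManifold 𝓘(ℝ, EJ) ∞ J] :
    let _ := hP.reducedChartedSpace hS hSK
    HasInducedCharts (EM × EJ) IP (Subtype.val : ↥(S ⁻¹' {1}) → P) := by
  let _ := hP.reducedChartedSpace hS hSK
  refine ⟨Topology.IsInducing.subtypeVal, ?_, ?_⟩
  · rintro _ ⟨q, rfl⟩
    obtain ⟨-, -, hsymm, he⟩ := hP.trivializationAt_spec (π q)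
    have h := hP.contMDiffOn_reducedTrivialization_symm hS hSK _ he hsymm
    have hc : ContMDiffOn 𝓘(ℝ, EM × EJ) (𝓘(ℝ, EM).prod 𝓘(ℝ, EJ)) ∞
        ((chartAt EM (π q)).prod (chartAt EJ (hP.trivializationAt (π q) q).2.1)).symm
        ((chartAt EM (π q)).prod (chartAt EJ (hP.trivializationAt (π q) q).2.1)).target := by
      intro y hy
      exact ((contMDiffAt_symm_of_mem_maximalAtlas (IsManifold.chart_mem_maximalAtlas _)
        hy.1).comp y (contDiff_fst.contMDiff y)).prodMk ((contMDiffAt_symm_of_mem_maximalAtlas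
        (IsManifold.chart_mem_maximalAtlas _) hy.2).comp y (contDiff_snd.contMDiff y))
        |>.contMDiffWithinAt
    refine h.comp (hc.mono fun y hy => ?_) fun y hy => ?_
    · exact hy.1
    · exact hy.2
  · rintro _ ⟨q₀, rfl⟩
    obtain ⟨-, hsm, -, he⟩ := hP.trivializationAt_spec (π q₀)
    set e := hP.trivializationAt (π q₀)
    -- The formula of the chart itself, read on P. The base coordinate is taken as `(e p).1` rather
    -- than `π p`, so that smoothness of e applies directly.
    refine ⟨fun p => (chartAt EM (π q₀) (e p).1, chartAt EJ (e q₀).2.1 (e p).2.1),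
      fun q hq => ?_⟩
    have hqe : (q : P) ∈ e.source := e.mem_source.2 hq.1
    constructor
    · simp only [e.coe_fst hqe]
      rfl
    · have h := contMDiffAt_trivialization_fst hsm hqe
      have hq1 : (e q).1 ∈ (chartAt EM (π q₀)).source := by
        rw [e.coe_fst hqe]
        exact hq.2.1
      have hq2 : (e q).2.1 ∈ (chartAt EJ (e q₀).2.1).source := hq.2.2
      rw [modelWithCornersSelf_prod, ← chartedSpaceSelf_prod]
      refine ContMDiffAt.prodMk ?_ ?_
      · exact ContMDiffAt.comp (q : P) (contMDiffAt_of_mem_maximalAtlas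
          (IsManifold.chart_mem_maximalAtlas _) hq1) h.fst
      · exact ContMDiffAt.comp (q : P) (contMDiffAt_of_mem_maximalAtlas
          (IsManifold.chart_mem_maximalAtlas _) hq2) h.snd

/-- The map `p ↦ (p S(p), S(p)⁻¹)` identifies `P` with the product of the reduced bundle and `K`. -/
def IsPrincipalBundle.diffeomorphProd [LieGroup IK ∞ K] [ChartedSpace (EM × EJ) ↥(S ⁻¹' {1})]
    (hQ : HasInducedCharts (EM × EJ) IP (Subtype.val : ↥(S ⁻¹' {1}) → P)) :
    P ≃ₘ^∞⟮IP, 𝓘(ℝ, EM × EJ).prod IK⟯ (↥(S ⁻¹' {1}) × K) where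
  toFun p := (retract act S hSK p, (S p)⁻¹)
  invFun y := act y.1 (1, y.2)
  left_inv p := by
    change act (act p (1, S p)) (1, (S p)⁻¹) = p
    simp [← hP.act_mul, hP.act_one, ← Prod.one_eq_mk]
  right_inv y := by
    refine Prod.ext ?_ ?_
    · exact (hP.retract_act_snd hSK _ _).trans (hP.retract_coe hSK _)
    · simp [hSK, apply_coe_eq_one y.1]
  contMDiff_toFun := (hQ.contMDiff_of_comp (hP.contMDiff_coe_retract hS hSK)).prodMk hS.inv
  contMDiff_invFun := hP.contMDiff_act.comp
    ((hQ.contMDiff.comp contMDiff_fst).prodMk (contMDiff_const.prodMk contMDiff_snd))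

-- Smoothness is checked in P by `hQ`. Equivariance of the trivializations survives the correction
-- by S(qj), which changes only the K-coordinate.
include hP hS in
theorem IsPrincipalBundle.reduced [ChartedSpace (EM × EJ) ↥(S ⁻¹' {1})]
    (hQ : HasInducedCharts (EM × EJ) IP (Subtype.val : ↥(S ⁻¹' {1}) → P)) :
    IsPrincipalBundle 𝓘(ℝ, EM) 𝓘(ℝ, EM × EJ) 𝓘(ℝ, EJ) (fun q : ↥(S ⁻¹' {1}) => π q)
      (actQ act S hSK) where
  act_one q := by
    rw [actQ, ← Prod.one_eq_mk, hP.act_one, hP.retract_coe]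
  act_mul q g h := by
    have h1 := hP.retract_act hSK (act q (g, 1)) h 1
    rw [← hP.act_mul] at h1
    simpa [actQ] using h1
  contMDiff_act := by
    refine hQ.contMDiff_of_comp ((hP.contMDiff_coe_retract hS hSK).comp (hP.contMDiff_act.comp
      ((hQ.contMDiff.comp contMDiff_fst).prodMk (contMDiff_snd.prodMk contMDiff_const))))
  proj_act q g := by
    simp [actQ, coe_retract, hP.proj_act]
  locally_trivial x := by
    obtain ⟨hx, hsm, hsymm, he⟩ := hP.trivializationAt_spec x
    set e := hP.trivializationAt x
    refine ⟨hP.reducedTrivialization hS hSK e he, hx, ?_, ?_, ?_⟩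
    · intro q hq
      have hqe : (q : P) ∈ e.source := e.mem_source.2 hq
      have h := (contMDiffAt_trivialization_fst hsm hqe).comp q (hQ.contMDiff q)
      refine h.contMDiffWithinAt.congr (fun y hy => ?_) ?_
      · exact Prod.ext (e.coe_fst (e.mem_source.2 hy)).symm rfl
      · exact Prod.ext (e.coe_fst hqe).symm rfl
    · exact hQ.contMDiffOn_of_comp (hP.contMDiffOn_reducedTrivialization_symm hS hSK e he hsymm)
    · intro q hq g
      have hqe : (q : P) ∈ e.source := e.mem_source.2 hq
      change (e (act (act q (g, 1)) (1, S (act q (g, 1))))).2.1 = (e q).2.1 * g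
      rw [← hP.act_mul, he _ hqe]
      simp

end Charts

/-! ### Components of forms with values in 𝔧 ⊕ 𝔨. -/

section ProductForms

variable {EM : Type*} [NormedAddCommGroup EM] [NormedSpace ℝ EM]
  {HM : Type*} [TopologicalSpace HM] {IM : ModelWithCorners ℝ EM HM}
  {EJ : Type*} [NormedAddCommGroup EJ] [NormedSpace ℝ EJ]
  {HJ : Type*} [TopologicalSpace HJ] {IJ : ModelWithCorners ℝ EJ HJ}
  {EK : Type*} [NormedAddCommGroup EK] [NormedSpace ℝ EK]
  {HK : Type*} [TopologicalSpace HK] {IK : ModelWithCorners ℝ EK HK}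
  {EP : Type*} [NormedAddCommGroup EP] [NormedSpace ℝ EP]
  {HP : Type*} [TopologicalSpace HP] {IP : ModelWithCorners ℝ EP HP}
  {M : Type*} [TopologicalSpace M] [ChartedSpace HM M]
  {J : Type*} [TopologicalSpace J] [ChartedSpace HJ J] [Group J]
  {K : Type*} [TopologicalSpace K] [ChartedSpace HK K] [Group K]
  {P : Type*} [TopologicalSpace P] [ChartedSpace HP P]

theorem lieFst_apply (X : EJ × EK) : (lieFst IJ IK J K X : EJ) = X.1 := by
  rw [lieFst, mfderiv_fst]
  rfl

theorem lieSnd_apply (X : EJ × EK) : (lieSnd IJ IK J K X : EK) = X.2 := by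
  rw [lieSnd, mfderiv_snd]
  rfl

theorem lieInl_apply (X : EJ) : (lieInl IJ IK J K X : EJ × EK) = (X, 0) := by
  rw [lieInl, mfderiv_prod_left]
  rfl

theorem lieInr_apply (X : EK) : (lieInr IJ IK J K X : EJ × EK) = (0, X) := by
  rw [lieInr, mfderiv_prod_right]
  rfl

theorem directSum_fstPart_sndPart (A : LieForm IP (IJ.prod IK) P (J × K)) :
    directSum IJ IK IP (fstPart IJ IK IP A) (sndPart IJ IK IP A) = A := by
  funext p
  ext v : 1
  change ((lieInl IJ IK J K (lieFst IJ IK J K (A p v)) : EJ × EK) +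
    lieInr IJ IK J K (lieSnd IJ IK J K (A p v)) : EJ × EK) = A p v
  erw [lieInl_apply, lieInr_apply, lieFst_apply, lieSnd_apply]
  exact Prod.ext (add_zero _) (zero_add _)

omit [Group J] [Group K] in
theorem fst_mfderiv {f : M → J × K} {x : M} (hf : MDifferentiableAt IM (IJ.prod IK) f x)
    (v : TangentSpace IM x) :
    (mfderiv IM (IJ.prod IK) f x v : EJ × EK).1 = mfderiv IM IJ (fun x => (f x).1) x v := by
  have h := mfderiv_comp_apply x (mdifferentiableAt_fst (I := IJ) (I' := IK) (x := f x)) hf v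
  rw [mfderiv_fst] at h
  exact h.symm

omit [Group J] [Group K] in
theorem mfderiv_comp_fst {f : J → M} {x : J × K} (hf : MDifferentiableAt IJ IM f x.1)
    (X : EJ × EK) :
    mfderiv (IJ.prod IK) IM (fun y : J × K => f y.1) x X = (mfderiv IJ IM f x.1 X.1 : EM) := by
  have h := mfderiv_comp_apply x hf (mdifferentiableAt_fst (I := IJ) (I' := IK) (x := x)) X
  rw [mfderiv_fst] at h
  exact h

/-- The projection J × K → J is a homomorphism, hence intertwines the two conjugations;
differentiate at 1. -/
theorem fst_Ad [LieGroup IJ ∞ J] [LieGroup IK ∞ K] (g : J × K) (X : EJ × EK) :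
    (Ad (IJ.prod IK) g X : EJ × EK).1 = Ad IJ g.1 X.1 := by
  have h1 : MDifferentiable (IJ.prod IK) (IJ.prod IK) (fun x : J × K => g * x * g⁻¹) :=
    ((contMDiff_mul_right (n := ∞) (a := g⁻¹)).comp
      (contMDiff_mul_left (n := ∞) (a := g))).mdifferentiable (by simp)
  have h2 : MDifferentiable IJ IJ (fun x : J => g.1 * x * g.1⁻¹) :=
    ((contMDiff_mul_right (n := ∞) (a := g.1⁻¹)).comp
      (contMDiff_mul_left (n := ∞) (a := g.1))).mdifferentiable (by simp)
  exact (fst_mfderiv (h1 1) X).trans (mfderiv_comp_fst (x := (1 : J × K)) (h2 _) X)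

theorem fst_maurerCartan [LieGroup IJ ∞ J] [LieGroup IK ∞ K] (g : J × K) (X : EJ × EK) :
    (maurerCartan (IJ.prod IK) g X : EJ × EK).1 = maurerCartan IJ g.1 X.1 := by
  have h1 : MDifferentiable (IJ.prod IK) (IJ.prod IK) (fun x : J × K => g⁻¹ * x) :=
    (contMDiff_mul_left (n := ∞) (a := g⁻¹)).mdifferentiable (by simp)
  have h2 : MDifferentiable IJ IJ (fun x : J => g.1⁻¹ * x) :=
    (contMDiff_mul_left (n := ∞) (a := g.1⁻¹)).mdifferentiable (by simp)
  exact (fst_mfderiv (h1 g) X).trans (mfderiv_comp_fst (h2 _) X)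

theorem maurerCartan_one (X : EJ) : (maurerCartan IJ (1 : J) X : EJ) = X := by
  have h : (fun x : J => (1 : J)⁻¹ * x) = id := by
    funext x
    simp
  rw [maurerCartan, h]
  erw [mfderiv_id]
  rfl

theorem Ad_one (X : EJ) : (Ad IJ (1 : J) X : EJ) = X := by
  have h : (fun x : J => (1 : J) * x * (1 : J)⁻¹) = id := by
    funext x
    simp
  rw [Ad, h]
  erw [mfderiv_id]
  rfl

theorem dress_const (B : LieForm IP IJ P J) (j : J) (p : P) (v : TangentSpace IP p) :
    dress IP IJ B (fun _ => j) p v = Ad IJ j⁻¹ (B p v) := by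
  simp only [dress]
  erw [mfderiv_const]
  simp

/-- The `𝔧`-component of `u⁻¹ A u + u⁻¹ du` only depends on the `J`-components of `A` and `u`. -/
theorem fstPart_dress [LieGroup IJ ∞ J] [LieGroup IK ∞ K] (A : LieForm IP (IJ.prod IK) P (J × K))
    {u : P → J × K} (hu : MDifferentiable IP (IJ.prod IK) u) :
    fstPart IJ IK IP (dress IP (IJ.prod IK) A u) =
      dress IP IJ (fstPart IJ IK IP A) (fun p => (u p).1) := by
  funext p
  ext v : 1
  have h1 : (fstPart IJ IK IP (dress IP (IJ.prod IK) A u) p v : EJ) =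
      (Ad (IJ.prod IK) (u p)⁻¹ (A p v) : EJ × EK).1 +
        (maurerCartan (IJ.prod IK) (u p) (mfderiv IP (IJ.prod IK) u p v) : EJ × EK).1 :=
    lieFst_apply _
  have h2 : (fstPart IJ IK IP A p v : EJ) = (A p v : EJ × EK).1 := lieFst_apply _
  refine h1.trans ?_
  erw [fst_Ad, fst_maurerCartan, fst_mfderiv (hu p), ← h2]
  rfl

/-- The J-component of the dressing field is the constant 1, which contributes neither a derivative
nor an adjoint twist. -/
theorem fstPart_dress_inK [LieGroup IJ ∞ J] [LieGroup IK ∞ K]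
    (A : LieForm IP (IJ.prod IK) P (J × K)) {S : P → K} (hS : ContMDiff IP IK ∞ S) :
    fstPart IJ IK IP (dress IP (IJ.prod IK) A (inK J S)) = fstPart IJ IK IP A := by
  have hu : ContMDiff IP (IJ.prod IK) ∞ (inK J S) := contMDiff_const.prodMk hS
  rw [fstPart_dress A (hu.mdifferentiable (by simp))]
  funext p
  ext v : 1
  refine (dress_const _ 1 p v).trans ?_
  rw [inv_one]
  exact Ad_one _

theorem dress_inK_eq_directSum [LieGroup IJ ∞ J] [LieGroup IK ∞ K]
    (A : LieForm IP (IJ.prod IK) P (J × K)) {S : P → K} (hS : ContMDiff IP IK ∞ S) :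
    dress IP (IJ.prod IK) A (inK J S) = directSum IJ IK IP (fstPart IJ IK IP A)
      (sndPart IJ IK IP (dress IP (IJ.prod IK) A (inK J S))) := by
  rw [← fstPart_dress_inK A hS, directSum_fstPart_sndPart]

theorem IsSmoothForm.fstPart [IsManifold IP ∞ P] {A : LieForm IP (IJ.prod IK) P (J × K)}
    (hA : IsSmoothForm IP (IJ.prod IK) A) : IsSmoothForm IP IJ (fstPart IJ IK IP A) := by
  have h : ContMDiff 𝓘(ℝ, EJ × EK) 𝓘(ℝ, EJ) ∞ (Prod.fst : EJ × EK → EJ) :=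
    contDiff_fst.contMDiff
  have hA' : ContMDiff IP.tangent 𝓘(ℝ, EJ × EK) (M' := EJ × EK) ∞
      (fun v : TangentBundle IP P => A v.proj v.snd) := hA
  exact (h.comp hA').congr fun v => lieFst_apply _

theorem IsSmoothForm.sndPart [IsManifold IP ∞ P] {A : LieForm IP (IJ.prod IK) P (J × K)}
    (hA : IsSmoothForm IP (IJ.prod IK) A) : IsSmoothForm IP IK (sndPart IJ IK IP A) := by
  have h : ContMDiff 𝓘(ℝ, EJ × EK) 𝓘(ℝ, EK) ∞ (Prod.snd : EJ × EK → EK) :=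
    contDiff_snd.contMDiff
  have hA' : ContMDiff IP.tangent 𝓘(ℝ, EJ × EK) (M' := EJ × EK) ∞
      (fun v : TangentBundle IP P => A v.proj v.snd) := hA
  exact (h.comp hA').congr fun v => lieSnd_apply _

end ProductForms

/-! ### The dressed form, the reduced connection and gauge invariance. -/

section ReducedForms

variable {EM : Type*} [NormedAddCommGroup EM] [NormedSpace ℝ EM]
  {HM : Type*} [TopologicalSpace HM] {IM : ModelWithCorners ℝ EM HM}
  {EP : Type*} [NormedAddCommGroup EP] [NormedSpace ℝ EP]
  {HP : Type*} [TopologicalSpace HP] {IP : ModelWithCorners ℝ EP HP}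
  {EJ : Type*} [NormedAddCommGroup EJ] [NormedSpace ℝ EJ]
  {HJ : Type*} [TopologicalSpace HJ] {IJ : ModelWithCorners ℝ EJ HJ}
  {EK : Type*} [NormedAddCommGroup EK] [NormedSpace ℝ EK]
  {HK : Type*} [TopologicalSpace HK] {IK : ModelWithCorners ℝ EK HK}
  {EQ : Type*} [NormedAddCommGroup EQ] [NormedSpace ℝ EQ]
  {HQ : Type*} [TopologicalSpace HQ] {IQ : ModelWithCorners ℝ EQ HQ}
  {M : Type*} [TopologicalSpace M] [ChartedSpace HM M]
  {P : Type*} [TopologicalSpace P] [ChartedSpace HP P] [IsManifold IP ∞ P]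
  {J : Type*} [TopologicalSpace J] [ChartedSpace HJ J] [Group J] [LieGroup IJ ∞ J]
  {K : Type*} [TopologicalSpace K] [ChartedSpace HK K] [Group K] [LieGroup IK ∞ K]
  {π : P → M} {act : P → J × K → P} {S : P → K}
  (hP : IsPrincipalBundle IM IP (IJ.prod IK) π act)
  {A : LieForm IP (IJ.prod IK) P (J × K)} (hA : IsConnection IP (IJ.prod IK) act A)
  (hS : ContMDiff IP IK ∞ S)
  (hSK : ∀ p k, S (act p (1, k)) = k⁻¹ * S p)

include hP hA hS

/-- The dressed form is the pullback of the connection form by the retraction `p ↦ p S(p)`. -/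
theorem IsConnection.dress_eq_pullback :
    dress IP (IJ.prod IK) A (inK J S) =
      pullback IP IP (IJ.prod IK) (fun p => (retract act S hSK p : P)) A := by
  have hu : ContMDiff IP (IJ.prod IK) ∞ (inK J S) := contMDiff_const.prodMk hS
  exact (pullback_act_eq_dress hP hA (hu.mdifferentiable (by simp))).symm

-- The pullback description spares any study of how `Ad` and `maurerCartan` depend smoothly on the
-- group element.
include hSK in
theorem IsConnection.isSmoothForm_dress :
    IsSmoothForm IP (IJ.prod IK) (dress IP (IJ.prod IK) A (inK J S)) := by
  rw [hA.dress_eq_pullback hP hS hSK]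
  exact hA.smooth.pullback (hP.contMDiff_coe_retract hS hSK)

/-- Both sides are pullbacks of A, and the underlying maps agree because the retraction is
idempotent. -/
theorem IsConnection.dress_eq_pullback_retract [ChartedSpace HQ ↥(S ⁻¹' {1})]
    (hι : MDifferentiable IQ IP (Subtype.val : ↥(S ⁻¹' {1}) → P))
    (hr : MDifferentiable IP IQ (retract act S hSK)) :
    dress IP (IJ.prod IK) A (inK J S) = pullback IP IQ (IJ.prod IK) (retract act S hSK)
      (pullback IQ IP (IJ.prod IK) (Subtype.val : ↥(S ⁻¹' {1}) → P)
        (dress IP (IJ.prod IK) A (inK J S))) := by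
  have hR := (hP.contMDiff_coe_retract hS hSK).mdifferentiable (by simp)
  have hRR : (fun p => (retract act S hSK p : P)) ∘ (Subtype.val ∘ retract act S hSK) =
      fun p => (retract act S hSK p : P) := by
    funext p
    simp [hP.retract_coe]
  rw [pullback_pullback _ hι hr, hA.dress_eq_pullback hP hS hSK,
    pullback_pullback _ hR (hι.comp hr), hRR]

/-- The `𝔧`-component of a connection form restricts to a connection form on the reduced bundle. -/
theorem IsConnection.reduced [ChartedSpace HQ ↥(S ⁻¹' {1})] [IsManifold IQ ∞ ↥(S ⁻¹' {1})]
    (hι : ContMDiff IQ IP ∞ (Subtype.val : ↥(S ⁻¹' {1}) → P))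
    (hQ : IsPrincipalBundle IM IQ IJ (fun q : ↥(S ⁻¹' {1}) => π q) (actQ act S hSK)) :
    IsConnection IQ IJ (actQ act S hSK)
      (pullback IQ IP IJ (Subtype.val : ↥(S ⁻¹' {1}) → P) (fstPart IJ IK IP A)) where
  smooth := hA.smooth.fstPart.pullback hι
  vertical q X := by
    have hι' := hι.mdifferentiable (by simp)
    have hq : MDifferentiable IJ IQ (fun j => actQ act S hSK q j) :=
      (hQ.contMDiff_act.comp (contMDiff_const.prodMk contMDiff_id)).mdifferentiable (by simp)
    -- In P, the J-orbit of q is j ↦ q w(j). The 𝔧-part of the Maurer-Cartan form along w sees only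
    -- the first component of w, the identity of J.
    set w : J → J × K := fun j => (j, S (act q (j, 1))) with hw
    have hwd : MDifferentiable IJ (IJ.prod IK) w :=
      (contMDiff_id.prodMk (hS.comp (hP.contMDiff_act.comp (contMDiff_const.prodMk
        (contMDiff_id.prodMk contMDiff_const))))).mdifferentiable (by simp)
    have hact : MDifferentiable (IJ.prod IK) IP (fun g => act (q : P) g) :=
      (hP.contMDiff_act.comp (contMDiff_const.prodMk contMDiff_id)).mdifferentiable (by simp)
    have hcomp : Subtype.val ∘ (fun j => actQ act S hSK q j) = (fun g => act (q : P) g) ∘ w := by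
      funext j
      simp [actQ, coe_retract, ← hP.act_mul, hw]
    have hd : (mfderiv IQ IP Subtype.val (actQ act S hSK q 1)
        (mfderiv IJ IQ (fun j => actQ act S hSK q j) 1 X) : EP) =
        mfderiv (IJ.prod IK) IP (fun g => act (q : P) g) (w 1) (mfderiv IJ (IJ.prod IK) w 1 X) := by
      refine (mfderiv_comp_apply 1 (hι' _) (hq 1) X).symm.trans ?_
      rw [hcomp]
      exact mfderiv_comp_apply 1 (hact _) (hwd 1) X
    have h1 := hA.apply_mfderiv_orbit hP q (w 1) (mfderiv IJ (IJ.prod IK) w 1 X)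
    refine (lieFst_apply _).trans ?_
    have h2 : (A (actQ act S hSK q 1 : P) (mfderiv IQ IP Subtype.val (actQ act S hSK q 1)
        (mfderiv IJ IQ (fun j => actQ act S hSK q j) 1 X)) : EJ × EK) =
        maurerCartan (IJ.prod IK) (w 1) (mfderiv IJ (IJ.prod IK) w 1 X) := by
      refine Eq.trans ?_ h1
      refine (LieForm.congr_point A (congrFun hcomp 1) _).trans ?_
      exact congrArg (A (act q (w 1))) hd
    refine (congrArg Prod.fst h2).trans ?_
    refine (fst_maurerCartan (w 1) _).trans ?_
    refine (maurerCartan_one _).trans ?_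
    refine (fst_mfderiv (hwd 1) X).trans ?_
    erw [mfderiv_id]
    rfl
  equivariant j q v := by
    have hι' := hι.mdifferentiable (by simp)
    have hR : MDifferentiable IQ IQ (fun q => actQ act S hSK q j) :=
      (hQ.contMDiff_act.comp (contMDiff_id.prodMk contMDiff_const)).mdifferentiable (by simp)
    -- The action of j on Q is the restriction of p ↦ p u(p). As the J-component of u is constant,
    -- the 𝔧-part of the pullback reduces to Ad(j⁻¹).
    set u : P → J × K := fun p => (j, S (act p (j, 1))) with hu
    have hus : ContMDiff IP (IJ.prod IK) ∞ u :=
      contMDiff_const.prodMk (hS.comp (hP.contMDiff_act.comp (contMDiff_id.prodMk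
        contMDiff_const)))
    have hud : MDifferentiable IP (IJ.prod IK) u := hus.mdifferentiable (by simp)
    have hud' : MDifferentiable IP IP (fun p => act p (u p)) :=
      (hP.contMDiff_act.comp (contMDiff_id.prodMk hus)).mdifferentiable (by simp)
    have hcomp : Subtype.val ∘ (fun q => actQ act S hSK q j) =
        (fun p => act p (u p)) ∘ Subtype.val := by
      funext q
      simp [actQ, coe_retract, ← hP.act_mul, hu]
    have h : pullback IQ IQ IJ (fun q => actQ act S hSK q j)
        (pullback IQ IP IJ Subtype.val (fstPart IJ IK IP A)) =
        pullback IQ IP IJ Subtype.val (dress IP IJ (fstPart IJ IK IP A) (fun _ => j)) := by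
      rw [pullback_pullback _ hι' hR, hcomp, ← pullback_pullback _ hud' hι',
        ← fstPart_dress A hud, ← pullback_act_eq_dress hP hA hud]
      rfl
    exact (congrArg (fun B : LieForm IQ IJ ↥(S ⁻¹' {1}) J => B q v) h).trans
      (dress_const _ j _ _)

include hSK in
/-- The action of a `K`-valued gauge transformation on connections and dressing fields, and the
invariance of the dressed form. -/
theorem IsConnection.dress_gauge {γ : P → K}
    (hγ : IsGaugeTransformation IP (IJ.prod IK) act (inK J γ)) :
    pullback IP IP (IJ.prod IK) (gaugeMap act (inK J γ)) A =
        dress IP (IJ.prod IK) A (inK J γ) ∧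
      S ∘ gaugeMap act (inK J γ) = (fun p => (γ p)⁻¹ * S p) ∧
      dress IP (IJ.prod IK) (pullback IP IP (IJ.prod IK) (gaugeMap act (inK J γ)) A)
        (inK J (S ∘ gaugeMap act (inK J γ))) = dress IP (IJ.prod IK) A (inK J S) := by
  have hΨ : MDifferentiable IP IP (gaugeMap act (inK J γ)) :=
    (hP.contMDiff_act.comp (contMDiff_id.prodMk hγ.smooth)).mdifferentiable (by simp)
  have hu : ContMDiff IP (IJ.prod IK) ∞ (inK J S) := contMDiff_const.prodMk hS
  have hR := (hP.contMDiff_coe_retract hS hSK).mdifferentiable (by simp)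
  refine ⟨pullback_act_eq_dress hP hA (hγ.smooth.mdifferentiable (by simp)),
    funext fun p => hSK p (γ p), ?_⟩
  -- By naturality the left side is Ψ^* of the dressed form, that is Ψ^* R^* A, and R ∘ Ψ = R since
  -- Ψ preserves K-orbits.
  have h1 := pullback_dress A hΨ (hu.mdifferentiable (by simp))
  refine h1.symm.trans ?_
  rw [hA.dress_eq_pullback hP hS hSK, pullback_pullback _ hR hΨ]
  congr 1
  funext p
  exact congrArg Subtype.val (hP.retract_act_snd hSK p (γ p))

end ReducedForms

end Dressing
end

/-! ### The main theorem. -/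

open Dressing in
theorem mainTheorem3
    {EM EP EJ EK : Type*}
    [NormedAddCommGroup EM] [NormedSpace ℝ EM] [FiniteDimensional ℝ EM]
    [NormedAddCommGroup EP] [NormedSpace ℝ EP] [FiniteDimensional ℝ EP]
    [NormedAddCommGroup EJ] [NormedSpace ℝ EJ] [FiniteDimensional ℝ EJ]
    [NormedAddCommGroup EK] [NormedSpace ℝ EK] [FiniteDimensional ℝ EK]
    {M : Type*} [TopologicalSpace M] [ChartedSpace EM M] [IsManifold 𝓘(ℝ, EM) ∞ M]
    {P : Type*} [TopologicalSpace P] [ChartedSpace EP P] [IsManifold 𝓘(ℝ, EP) ∞ P]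
    {J : Type*} [TopologicalSpace J] [ChartedSpace EJ J] [Group J] [LieGroup 𝓘(ℝ, EJ) ∞ J]
    {K : Type*} [TopologicalSpace K] [ChartedSpace EK K] [Group K] [LieGroup 𝓘(ℝ, EK) ∞ K]
    -- the principal bundle `P → M` with structure group `H = J × K`
    (π : P → M) (act : P → J × K → P)
    (hP : IsPrincipalBundle 𝓘(ℝ, EM) 𝓘(ℝ, EP) (𝓘(ℝ, EJ).prod 𝓘(ℝ, EK)) π act)
    -- the connection on `P`
    (A : LieForm 𝓘(ℝ, EP) (𝓘(ℝ, EJ).prod 𝓘(ℝ, EK)) P (J × K))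
    (hA : IsConnection 𝓘(ℝ, EP) (𝓘(ℝ, EJ).prod 𝓘(ℝ, EK)) act A)
    -- the dressing field
    (S : P → K) (hS : ContMDiff 𝓘(ℝ, EP) 𝓘(ℝ, EK) ∞ S)
    (hSK : ∀ p k, S (act p (1, k)) = k⁻¹ * S p) :
    let IH := 𝓘(ℝ, EJ).prod 𝓘(ℝ, EK)
    let Q := ↥(S ⁻¹' {1})
    let IQ := 𝓘(ℝ, EM × EJ)
    let Ahat := dress 𝓘(ℝ, EP) IH A (inK J S)
    -- `Q` is a submanifold of `P` and a `J`-principal bundle over `M`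
    (∃ (_ : ChartedSpace (EM × EJ) Q) (_ : IsManifold IQ ∞ Q),
      Manifold.IsSmoothEmbedding IQ 𝓘(ℝ, EP) ∞ (Subtype.val : Q → P) ∧
      IsPrincipalBundle 𝓘(ℝ, EM) IQ 𝓘(ℝ, EJ) (fun q : Q => π q) (actQ act S hSK) ∧
      -- `p ↦ p S(p)` is a morphism of bundles from `P` to `Q` over the projection `J × K → J`,
      -- and `P` is the product `Q × K`, as a `K`-space
      (∀ p j k, retract act S hSK (act p (j, k)) = actQ act S hSK (retract act S hSK p) j) ∧
      (∃ Φ : P ≃ₘ^∞⟮𝓘(ℝ, EP), IQ.prod 𝓘(ℝ, EK)⟯ (Q × K),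
        (∀ p, Φ p = (retract act S hSK p, (S p)⁻¹)) ∧
        ∀ p k, Φ (act p (1, k)) = ((Φ p).1, (Φ p).2 * k)) ∧
      -- the dressed form is the pullback to `P` of its restriction to `Q`
      Ahat = pullback 𝓘(ℝ, EP) IQ IH (retract act S hSK)
        (pullback IQ 𝓘(ℝ, EP) IH (Subtype.val : Q → P) Ahat) ∧
      -- its restriction to `Q` splits
      pullback IQ 𝓘(ℝ, EP) IH (Subtype.val : Q → P) Ahat =
        directSum 𝓘(ℝ, EJ) 𝓘(ℝ, EK) IQ
          (pullback IQ 𝓘(ℝ, EP) 𝓘(ℝ, EJ) (Subtype.val : Q → P)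
            (fstPart 𝓘(ℝ, EJ) 𝓘(ℝ, EK) 𝓘(ℝ, EP) A))
          (pullback IQ 𝓘(ℝ, EP) 𝓘(ℝ, EK) (Subtype.val : Q → P)
            (sndPart 𝓘(ℝ, EJ) 𝓘(ℝ, EK) 𝓘(ℝ, EP) Ahat)) ∧
      IsConnection IQ 𝓘(ℝ, EJ) (actQ act S hSK)
        (pullback IQ 𝓘(ℝ, EP) 𝓘(ℝ, EJ) (Subtype.val : Q → P)
          (fstPart 𝓘(ℝ, EJ) 𝓘(ℝ, EK) 𝓘(ℝ, EP) A)) ∧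
      IsSmoothForm IQ 𝓘(ℝ, EK)
        (pullback IQ 𝓘(ℝ, EP) 𝓘(ℝ, EK) (Subtype.val : Q → P)
          (sndPart 𝓘(ℝ, EJ) 𝓘(ℝ, EK) 𝓘(ℝ, EP) Ahat))) ∧
    -- the dressed form is a smooth 1-form on `P`, and splits there
    IsSmoothForm 𝓘(ℝ, EP) IH Ahat ∧
    Ahat = directSum 𝓘(ℝ, EJ) 𝓘(ℝ, EK) 𝓘(ℝ, EP)
      (fstPart 𝓘(ℝ, EJ) 𝓘(ℝ, EK) 𝓘(ℝ, EP) A) (sndPart 𝓘(ℝ, EJ) 𝓘(ℝ, EK) 𝓘(ℝ, EP) Ahat) ∧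
    -- invariance under the `K`-valued gauge transformations, which act geometrically by
    -- `A ↦ Ψ^* A` and `S ↦ Ψ^* S`, that is by `A ↦ γ⁻¹ A γ + γ⁻¹ dγ` and `S ↦ γ⁻¹ S`
    (∀ γ : P → K, IsGaugeTransformation 𝓘(ℝ, EP) IH act (inK J γ) →
      let Ψ := gaugeMap act (inK J γ)
      pullback 𝓘(ℝ, EP) 𝓘(ℝ, EP) IH Ψ A = dress 𝓘(ℝ, EP) IH A (inK J γ) ∧
      S ∘ Ψ = (fun p => (γ p)⁻¹ * S p) ∧
      dress 𝓘(ℝ, EP) IH (pullback 𝓘(ℝ, EP) 𝓘(ℝ, EP) IH Ψ A) (inK J (S ∘ Ψ)) = Ahat) := by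
  have hdir := dress_inK_eq_directSum A hS
  have hsm := hA.isSmoothForm_dress hP hS hSK
  refine ⟨?_, hsm, hdir, fun γ hγ => hA.dress_gauge hP hS hSK hγ⟩
  have : IsManifold 𝓘(ℝ, EJ) ∞ J := inferInstance
  have : IsManifold 𝓘(ℝ, EK) ∞ K := inferInstance
  let _ := hP.reducedChartedSpace hS hSK
  have hQ := hP.hasInducedCharts hS hSK
  have hQm := hQ.isManifold
  have hι := hQ.contMDiff
  have hr : ContMDiff 𝓘(ℝ, EP) 𝓘(ℝ, EM × EJ) ∞ (retract act S hSK) :=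
    hQ.contMDiff_of_comp (hP.contMDiff_coe_retract hS hSK)
  have hQP := hP.reduced hS hSK hQ
  -- The diffeomorphism P ≃ Q × K sends a point q of Q to (q, S(q)⁻¹) = (q, 1), so the inclusion is
  -- a slice.
  have himm := isImmersionOfComplement_of_diffeomorph_prod (hP.diffeomorphProd hS hSK hQ) 1
    (f := Subtype.val) fun q => Prod.ext (hP.retract_coe hSK q)
      (inv_eq_one.2 (apply_coe_eq_one (S := S) q))
  refine ⟨inferInstance, hQm, ⟨himm.isImmersion, Topology.IsEmbedding.subtypeVal⟩, hQP,
    hP.retract_act hSK, ⟨hP.diffeomorphProd hS hSK hQ, fun _ => rfl, fun p k => ?_⟩,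
    hA.dress_eq_pullback_retract hP hS hSK (hι.mdifferentiable (by simp))
      (hr.mdifferentiable (by simp)), ?_, hA.reduced hP hS hSK hι hQP,
    hsm.sndPart.pullback hι⟩
  · refine Prod.ext (hP.retract_act_snd hSK p k) ?_
    change (S (act p (1, k)))⁻¹ = (S p)⁻¹ * k
    simp [hSK]
  -- Pullback commutes with `directSum` definitionally, so the splitting on P restricts to the one
  -- on Q.
  · exact congrArg (pullback 𝓘(ℝ, EM × EJ) 𝓘(ℝ, EP) (𝓘(ℝ, EJ).prod 𝓘(ℝ, EK)) Subtype.val) hdir
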